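/- Fix $n,m\ge 0$. Let $\rho:\mathbb{R}_{\ge 0}\to[0,1]$ be continuous with $\rho(0)=1$ and $\lim_{x\to\infty}\rho(x)=0$, let $\phi:\mathbb{R}^2\to\mathbb{R}^m$ and $\psi:\mathbb{R}^m\to\mathbb{R}$ be functions, applied row-wise to $n\times 2$ and $n\times m$ matrices, and let $f:\mathbb{R}^{n\times n}\to\mathbb{R}^n$ satisfy $f(PVQ)=Pf(V)$ for every $V\in\mathbb{R}^{n\times n}$, every permutation matrix $P\in S_n$ and every orthogonal matrix $Q\in O(n)$. For a simple undirected graph $G$ with nodes $1,\dots,n$ and Laplacian $L=D-A$, let $\lambda_1<\dots<\lambda_K$ be the distinct eigenvalues of $L$, $\mu_j$ the multiplicity of $\lambda_j$, and $V_j\in\mathbb{R}^{n\times\mu_j}$ a matrix whose columns form an orthonormal basis of the eigenspace of $\lambda_j$ (an arbitrary choice is made for each graph). Put $$V_j^{\mathrm{smooth}}=\big[V_1\rho(|\lambda_1-\lambda_j|),\dots,V_K\rho(|\lambda_K-\lambda_j|)\big]\in\mathbb{R}^{n\times n},\qquad Z(G)=\psi\Big(\sum_{j=1}^K\mu_j\,\phi\big([\lambda_j\mathbf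 1_n,\ f(V_j^{\mathrm{smooth}})]\big)\Big)\in\mathbb{R}^n .$$ Assume that there are constants $J_\psi,J_\phi,J_\rho\ge 0$, $J_f>0$ and $\delta>0$ such that 1. $\|\psi(X)-\psi(X')\|_F\le J_\psi\|X-X'\|_F$ for all $X,X'\in\mathbb{R}^{n\times m}$, $\|\phi(X)-\phi(X')\|_F\le J_\phi\|X-X'\|_F$ for all $X,X'\in\mathbb{R}^{n\times 2}$, and $|\rho(x)-\rho(x')|\le J_\rho|x-x'|$ for all $x,x'\ge 0$; 2. $\|f(X)-f(X')\|\le J_f\min_{Q\in O(n)}\|X-X'Q\|_F$ for all $X,X'\in\mathbb{R}^{n\times n}$; 3. $\rho(x)=0$ for all $x>\delta$. For graphs $G,G'$ on $n$ nodes with Laplacians $L,L'$, let $P_*\in S_n$ be any minimizer of $\|L-PL'P^T\|_F$ over $P\in S_n$. Then $Z$ is stable on graphs with $n$ nodes: there are constants $c,C>0$ with $\|Z(G)-P_*Z(G')\|_F\le C\,\|L-P_*L'P_*^T\|_F^{\,c}$ for all such $G,G',P_*$; and one may take $c=1/2$. To be specific, for every value of $\delta$ and $\rho$ as above and all such $G,G',P_*$,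 $$\|Z(G)-P_*Z(G')\|_F\le nJ_\psi J_\phi\Big[(\sqrt n+2nJ_\rho J_f)\,\|L-P_*L'P_*^T\|_2+4\sqrt[4]{2}\,J_f\sqrt{J_\rho}\,n\,\|L-P_*L'P_*^T\|_F^{1/2}\Big],$$ where $\|\cdot\|_2$ is the spectral norm, and $\|L-P_*L'P_*^T\|_2\le\|L-P_*L'P_*^T\|_F$. -/

import Mathlib

open scoped NNReal Matrix

noncomputable section

namespace OGE

/-- The Frobenius norm of a real matrix. A vector of `ℝⁿ` is treated as an `n × 1` matrix, whose
Frobenius norm is the Euclidean norm. -/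
def frobNorm {a b : ℕ} (A : Matrix (Fin a) (Fin b) ℝ) : ℝ :=
  letI := Matrix.frobeniusNormedAddCommGroup (m := Fin a) (n := Fin b) (α := ℝ)
  ‖A‖

/-- The spectral norm (operator norm between Euclidean spaces) of a real matrix. -/
def specNorm {a b : ℕ} (A : Matrix (Fin a) (Fin b) ℝ) : ℝ :=
  letI := Matrix.instL2OpNormedAddCommGroup (m := Fin a) (n := Fin b) (𝕜 := ℝ)
  ‖A‖

/-- The Laplacian `D - A` of a simple undirected graph with nodes labeled by `Fin n`. -/
def laplacian {n : ℕ} (G : SimpleGraph (Fin n)) : Matrix (Fin n) (Fin n) ℝ :=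
  open Classical in G.lapMatrix ℝ

/-- An orthonormal basis of eigenvectors of `L`, listed with increasing eigenvalues. If
`λ₁ < ⋯ < λ_K` are the distinct eigenvalues and the columns of `V_j` are mutually orthogonal
normalized eigenvectors spanning the eigenspace of `λ_j`, then `vec` is `concat [V₁, …, V_K]`, and
`val k` is the eigenvalue of its `k`-th column. -/
structure Eigenbasis {n : ℕ} (L : Matrix (Fin n) (Fin n) ℝ) where
  /-- the eigenvalues, repeated according to multiplicity -/
  val : Fin n → ℝ
  /-- the matrix whose columns are the eigenvectors -/
  vec : Matrix (Fin n) (Fin n) ℝ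
  monotone_val : Monotone val
  orthonormal : vecᵀ * vec = 1
  eigen : L * vec = vec * Matrix.diagonal val

namespace Eigenbasis

variable {n : ℕ} {L : Matrix (Fin n) (Fin n) ℝ}

/-- The finite set of distinct eigenvalues. -/
def distinct (E : Eigenbasis L) : Finset ℝ :=
  Finset.univ.image E.val

/-- The multiplicity of an eigenvalue. -/
def mult (E : Eigenbasis L) (lam : ℝ) : ℕ :=
  (Finset.univ.filter fun k => E.val k = lam).card

/-- The matrix `concat [V₁ ρ(|λ₁ - lam|), …, V_K ρ(|λ_K - lam|)]`. -/
def smooth (E : Eigenbasis L) (ρ : ℝ≥0 → ℝ) (lam : ℝ) : Matrix (Fin n) (Fin n) ℝ :=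
  Matrix.of fun i k => E.vec i k * ρ (Real.nnabs (E.val k - lam))

end Eigenbasis

/-- Every graph Laplacian has such an eigenbasis. -/
theorem nonempty_eigenbasis {n : ℕ} (G : SimpleGraph (Fin n)) :
    Nonempty (Eigenbasis (laplacian G)) := by
  classical
  have hA : (laplacian G).IsHermitian := by
    rw [Matrix.IsHermitian, Matrix.conjTranspose_eq_transpose_of_trivial]
    exact G.isSymm_lapMatrix (R := ℝ)
  let s : Equiv.Perm (Fin n) := Tuple.sort hA.eigenvalues
  let U : Matrix (Fin n) (Fin n) ℝ := hA.eigenvectorUnitary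
  have hU : Uᵀ * U = 1 := by
    have h := Unitary.coe_star_mul_self hA.eigenvectorUnitary
    rwa [Matrix.star_eq_conjTranspose, Matrix.conjTranspose_eq_transpose_of_trivial] at h
  refine ⟨⟨hA.eigenvalues ∘ s, U.submatrix id s, Tuple.monotone_sort _, ?_, ?_⟩⟩
  · rw [Matrix.transpose_submatrix, ← Matrix.submatrix_mul _ _ s id s Function.bijective_id, hU,
      Matrix.submatrix_one_equiv]
  · ext i k
    have h := congrFun (hA.mulVec_eigenvectorBasis (s k)) i
    rw [Matrix.mul_diagonal]
    simpa [Matrix.mul_apply, Matrix.mulVec, dotProduct, U, mul_comm] using h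

/-- `ρ : ℝ≥0 → [0, 1]` is a smoothing function. -/
structure IsSmoothing (ρ : ℝ≥0 → ℝ) : Prop where
  mem_Icc : ∀ x, ρ x ∈ Set.Icc (0 : ℝ) 1
  continuous : Continuous ρ
  map_zero : ρ 0 = 1
  tendsto : Filter.Tendsto ρ Filter.atTop (nhds 0)

/-- `f : ℝ^{n×n} → ℝⁿ` is invariant under rotations by `O(n)` and permutation-equivariant:
`f (P V Q) = P f(V)` for all permutation matrices `P` and `Q ∈ O(n)`. -/
def IsInvariantEncoder {n : ℕ}
    (f : Matrix (Fin n) (Fin n) ℝ → Matrix (Fin n) (Fin 1) ℝ) : Prop :=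
  ∀ (σ : Equiv.Perm (Fin n)) (Q : Matrix.orthogonalGroup (Fin n) ℝ) (V : Matrix (Fin n) (Fin n) ℝ),
    f (σ.permMatrix ℝ * V * (Q : Matrix (Fin n) (Fin n) ℝ)) = σ.permMatrix ℝ * f V

/-- Row-wise application of `g : ℝᵃ → ℝᵇ` to an `n × a` matrix. -/
def rowwise {a b : ℕ} (n : ℕ) (g : (Fin a → ℝ) → Fin b → ℝ) (X : Matrix (Fin n) (Fin a) ℝ) :
    Matrix (Fin n) (Fin b) ℝ :=
  Matrix.of fun i => g (X i)

/-- Row-wise application of `g : ℝᵃ → ℝ` to an `n × a` matrix. -/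
def rowwiseScalar {a : ℕ} (n : ℕ) (g : (Fin a → ℝ) → ℝ) (X : Matrix (Fin n) (Fin a) ℝ) :
    Matrix (Fin n) (Fin 1) ℝ :=
  Matrix.of fun i _ => g (X i)

/-- The `n × 2` matrix `concat [lam 1ₙ, v]`. -/
def concatConst {n : ℕ} (lam : ℝ) (v : Matrix (Fin n) (Fin 1) ℝ) : Matrix (Fin n) (Fin 2) ℝ :=
  Matrix.of fun i => ![lam, v i 0]

/-- The augmentation `Z = ψ (∑_j μ_j φ (concat [λ_j 1ₙ, f (V_j^smooth)]))`, the sum running over the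
distinct eigenvalues. -/
def ogeAug {n m : ℕ} (ψ : (Fin m → ℝ) → ℝ) (φ : (Fin 2 → ℝ) → Fin m → ℝ)
    (f : Matrix (Fin n) (Fin n) ℝ → Matrix (Fin n) (Fin 1) ℝ) (ρ : ℝ≥0 → ℝ)
    {L : Matrix (Fin n) (Fin n) ℝ} (E : Eigenbasis L) : Matrix (Fin n) (Fin 1) ℝ :=
  rowwiseScalar n ψ
    (∑ lam ∈ E.distinct,
      (E.mult lam : ℝ) • rowwise n φ (concatConst lam (f (E.smooth ρ lam))))

/-- The perturbation `L - P L' Pᵀ` of Laplacians, for the permutation matrix `P` of `σ`. -/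
def lapDiff {n : ℕ} (G G' : SimpleGraph (Fin n)) (σ : Equiv.Perm (Fin n)) :
    Matrix (Fin n) (Fin n) ℝ :=
  laplacian G - σ.permMatrix ℝ * laplacian G' * (σ.permMatrix ℝ)ᵀ

/-- `σ` attains the minimum of `‖L - P L' Pᵀ‖_F` over all permutation matrices `P`. -/
def IsOptimalMatching {n : ℕ} (G G' : SimpleGraph (Fin n)) (σ : Equiv.Perm (Fin n)) : Prop :=
  ∀ τ : Equiv.Perm (Fin n), frobNorm (lapDiff G G' σ) ≤ frobNorm (lapDiff G G' τ)

/-- An optimal matching always exists. -/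
theorem exists_isOptimalMatching {n : ℕ} (G G' : SimpleGraph (Fin n)) :
    ∃ σ, IsOptimalMatching G G' σ :=
  Finite.exists_min fun σ => frobNorm (lapDiff G G' σ)

/-- `‖Z(G) - P_* Z(G')‖_F ≤ C ‖L - P_* L' P_*ᵀ‖_F ^ c` for all graphs with `n` nodes and some
constant `C > 0`. -/
def IsStableWithExponent {n d : ℕ} (Z : SimpleGraph (Fin n) → Matrix (Fin n) (Fin d) ℝ)
    (c : ℝ) : Prop :=
  ∃ C : ℝ, 0 < C ∧ ∀ (G G' : SimpleGraph (Fin n)) (σ : Equiv.Perm (Fin n)),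
    IsOptimalMatching G G' σ →
      frobNorm (Z G - σ.permMatrix ℝ * Z G') ≤ C * frobNorm (lapDiff G G' σ) ^ c

/-- Stability of a node feature augmentation. -/
def IsStable {n d : ℕ} (Z : SimpleGraph (Fin n) → Matrix (Fin n) (Fin d) ℝ) : Prop :=
  ∃ c : ℝ, 0 < c ∧ IsStableWithExponent Z c

end OGE

end

/-! Fix orthonormal eigenbases `V`, `V'` of symmetric matrices `L`, `L'`, and let `W = Vᵀ V'`. The
rotation `Wᵀ` aligns `V'` with `V`, and `‖V D - V' D' Wᵀ‖_F² = ∑ (d_i - d'_j)² W_ij²` for all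
diagonal `D`, `D'` (`frobNorm_diagonal_sub_sq`). No spectral gap enters. With the eigenvalues on the
diagonal the sum is `‖L - L'‖_F²`; with values of `ρ` it measures the smoothed eigenvectors, so the
regularity of `ρ` compares the two. The centres of smoothing move by at most `‖L - L'‖₂`, by Weyl's
inequality. Weighting by multiplicity turns the sum over distinct eigenvalues into a sum over
indices `k`, so terms are matched by index even when multiplicities differ. The matching permutation
is absorbed by equivariance: `P Z(G')` is the augmentation of `P L' Pᵀ`. -/

namespace OGE

/-! ### Frobenius and spectral norms. -/

section Norms

variable {a b c : ℕ}

theorem frobNorm_nonneg (A : Matrix (Fin a) (Fin b) ℝ) : 0 ≤ frobNorm A :=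
  letI := Matrix.frobeniusNormedAddCommGroup (m := Fin a) (n := Fin b) (α := ℝ)
  norm_nonneg A

theorem frobNorm_sum_le {ι : Type*} (s : Finset ι) (A : ι → Matrix (Fin a) (Fin b) ℝ) :
    frobNorm (∑ i ∈ s, A i) ≤ ∑ i ∈ s, frobNorm (A i) :=
  letI := Matrix.frobeniusNormedAddCommGroup (m := Fin a) (n := Fin b) (α := ℝ)
  norm_sum_le s A

theorem frobNorm_sq (A : Matrix (Fin a) (Fin b) ℝ) :
    frobNorm A ^ 2 = ∑ i, ∑ j, A i j ^ 2 := by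
  have h : frobNorm A = (∑ i, ∑ j, ‖A i j‖ ^ (2 : ℝ)) ^ (1 / 2 : ℝ) :=
    Matrix.frobenius_norm_def A
  rw [h, ← Real.sqrt_eq_rpow, Real.sq_sqrt (by positivity)]
  simp

theorem frobNorm_sq_eq_trace (A : Matrix (Fin a) (Fin b) ℝ) :
    frobNorm A ^ 2 = (Aᵀ * A).trace := by
  rw [frobNorm_sq, Finset.sum_comm]
  simp [Matrix.trace, Matrix.mul_apply, sq]

theorem frobNorm_transpose (A : Matrix (Fin a) (Fin b) ℝ) : frobNorm Aᵀ = frobNorm A :=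
  Matrix.frobenius_norm_transpose A

theorem frobNorm_orthogonal_mul {U : Matrix (Fin a) (Fin a) ℝ} (hU : Uᵀ * U = 1)
    (A : Matrix (Fin a) (Fin b) ℝ) : frobNorm (U * A) = frobNorm A := by
  refine (sq_eq_sq₀ (frobNorm_nonneg _) (frobNorm_nonneg _)).1 ?_
  rw [frobNorm_sq_eq_trace, frobNorm_sq_eq_trace, Matrix.transpose_mul, Matrix.mul_assoc,
    ← Matrix.mul_assoc Uᵀ, hU, Matrix.one_mul]

theorem frobNorm_mul_orthogonal {U : Matrix (Fin b) (Fin b) ℝ} (hU : U * Uᵀ = 1)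
    (A : Matrix (Fin a) (Fin b) ℝ) : frobNorm (A * U) = frobNorm A := by
  rw [← frobNorm_transpose, Matrix.transpose_mul, frobNorm_orthogonal_mul (by simpa using hU),
    frobNorm_transpose]

theorem norm_toLp_sq (x : Fin a → ℝ) : ‖WithLp.toLp 2 x‖ ^ 2 = x ⬝ᵥ x := by
  rw [EuclideanSpace.norm_sq_eq]
  simp [dotProduct, sq]

theorem specNorm_nonneg (A : Matrix (Fin a) (Fin b) ℝ) : 0 ≤ specNorm A :=
  letI := Matrix.instL2OpNormedAddCommGroup (m := Fin a) (n := Fin b) (𝕜 := ℝ)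
  norm_nonneg A

theorem norm_mulVec_le_specNorm (A : Matrix (Fin a) (Fin b) ℝ) (x : Fin b → ℝ) :
    ‖WithLp.toLp 2 (A *ᵥ x)‖ ≤ specNorm A * ‖WithLp.toLp 2 x‖ :=
  Matrix.l2_opNorm_mulVec A (WithLp.toLp 2 x)

theorem specNorm_le_frobNorm (A : Matrix (Fin a) (Fin b) ℝ) : specNorm A ≤ frobNorm A := by
  have h : specNorm A = _ := Matrix.l2_opNorm_def A
  rw [h]
  refine ContinuousLinearMap.opNorm_le_bound _ (frobNorm_nonneg A) fun x => ?_
  change ‖WithLp.toLp 2 (A *ᵥ x.ofLp)‖ ≤ _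
  refine le_of_sq_le_sq ?_ (by have := frobNorm_nonneg A; positivity)
  rw [mul_pow, EuclideanSpace.norm_sq_eq, EuclideanSpace.norm_sq_eq, frobNorm_sq, Finset.sum_mul]
  refine Finset.sum_le_sum fun i _ => ?_
  simpa [Matrix.mulVec, dotProduct] using
    Finset.sum_mul_sq_le_sq_mul_sq Finset.univ (A i) x.ofLp

theorem dotProduct_mulVec_le_specNorm (A : Matrix (Fin a) (Fin a) ℝ) (x : Fin a → ℝ) :
    x ⬝ᵥ A *ᵥ x ≤ specNorm A * (x ⬝ᵥ x) := by
  have h := real_inner_le_norm (WithLp.toLp 2 (A *ᵥ x)) (WithLp.toLp 2 x)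
  rw [EuclideanSpace.inner_toLp_toLp] at h
  rw [← norm_toLp_sq]
  calc x ⬝ᵥ A *ᵥ x ≤ ‖WithLp.toLp 2 (A *ᵥ x)‖ * ‖WithLp.toLp 2 x‖ := by simpa using h
    _ ≤ specNorm A * ‖WithLp.toLp 2 x‖ * ‖WithLp.toLp 2 x‖ := by
      gcongr
      exact norm_mulVec_le_specNorm A x
    _ = _ := by ring

theorem specNorm_sub_comm (A B : Matrix (Fin a) (Fin b) ℝ) :
    specNorm (A - B) = specNorm (B - A) :=
  letI := Matrix.instL2OpNormedAddCommGroup (m := Fin a) (n := Fin b) (𝕜 := ℝ)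
  norm_sub_rev A B

end Norms

/-! ### Weyl's inequality and the overlap of two eigenbases. -/

namespace Eigenbasis

variable {n : ℕ} {L L' : Matrix (Fin n) (Fin n) ℝ}

theorem vec_mul_transpose (E : Eigenbasis L) : E.vec * E.vecᵀ = 1 :=
  mul_eq_one_comm.1 E.orthonormal

theorem spectral (E : Eigenbasis L) : L = E.vec * Matrix.diagonal E.val * E.vecᵀ := by
  rw [← E.eigen, Matrix.mul_assoc, E.vec_mul_transpose, Matrix.mul_one]

theorem sum_coord_sq (E : Eigenbasis L) (x : Fin n → ℝ) :
    ∑ j, (E.vecᵀ *ᵥ x) j ^ 2 = x ⬝ᵥ x := by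
  have h : (E.vecᵀ *ᵥ x) ⬝ᵥ (E.vecᵀ *ᵥ x) = x ⬝ᵥ x := by
    rw [Matrix.dotProduct_mulVec, Matrix.vecMul_transpose, Matrix.mulVec_mulVec,
      E.vec_mul_transpose, Matrix.one_mulVec]
  rw [← h]
  simp [dotProduct, sq]

theorem quadForm (E : Eigenbasis L) (x : Fin n → ℝ) :
    x ⬝ᵥ L *ᵥ x = ∑ j, E.val j * (E.vecᵀ *ᵥ x) j ^ 2 := by
  conv_lhs => rw [E.spectral]
  rw [← Matrix.mulVec_mulVec, ← Matrix.mulVec_mulVec, Matrix.dotProduct_mulVec,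
    ← Matrix.mulVec_transpose]
  simp only [dotProduct, Matrix.mulVec_diagonal]
  exact Finset.sum_congr rfl fun j _ => by ring

/-- One half of Weyl's perturbation inequality. -/
theorem val_sub_val_le (E : Eigenbasis L) (E' : Eigenbasis L') (k : Fin n) :
    E.val k - E'.val k ≤ specNorm (L - L') := by
  -- The zero row `k` makes the matrix singular. A kernel vector is orthogonal to the eigenvectors
  -- of `L` before `k` and to those of `L'` after `k`: the dimension count of Courant–Fischer.
  obtain ⟨x, hx, hMx⟩ : ∃ x : Fin n → ℝ, x ≠ 0 ∧
      (Matrix.of fun i => if i < k then E.vecᵀ i else if i = k then 0 else E'.vecᵀ i) *ᵥ x = 0 :=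
    Matrix.exists_mulVec_eq_zero_iff.2 (Matrix.det_eq_zero_of_row_eq_zero k (by simp))
  have h1 : ∀ j, j < k → (E.vecᵀ *ᵥ x) j = 0 := fun j hj => by
    simpa [Matrix.mulVec, hj] using congrFun hMx j
  have h2 : ∀ j, k < j → (E'.vecᵀ *ᵥ x) j = 0 := fun j hj => by
    simpa [Matrix.mulVec, hj.not_gt, hj.ne'] using congrFun hMx j
  have hpos : 0 < x ⬝ᵥ x := lt_of_le_of_ne (Finset.sum_nonneg fun i _ => mul_self_nonneg _)
    fun h => hx (dotProduct_self_eq_zero.1 h.symm)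
  have lower : E.val k * (x ⬝ᵥ x) ≤ x ⬝ᵥ L *ᵥ x := by
    rw [E.quadForm, ← E.sum_coord_sq, Finset.mul_sum]
    refine Finset.sum_le_sum fun j _ => ?_
    rcases lt_or_ge j k with hj | hj
    · simp [h1 j hj]
    · exact mul_le_mul_of_nonneg_right (E.monotone_val hj) (sq_nonneg _)
  have upper : x ⬝ᵥ L' *ᵥ x ≤ E'.val k * (x ⬝ᵥ x) := by
    rw [E'.quadForm, ← E'.sum_coord_sq, Finset.mul_sum]
    refine Finset.sum_le_sum fun j _ => ?_
    rcases lt_or_ge k j with hj | hj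
    · simp [h2 j hj]
    · exact mul_le_mul_of_nonneg_right (E'.monotone_val hj) (sq_nonneg _)
  have hquad := dotProduct_mulVec_le_specNorm (L - L') x
  rw [Matrix.sub_mulVec, dotProduct_sub] at hquad
  exact le_of_mul_le_mul_right (by linarith) hpos

/-- Weyl's perturbation inequality. -/
theorem abs_val_sub_val_le (E : Eigenbasis L) (E' : Eigenbasis L') (k : Fin n) :
    |E.val k - E'.val k| ≤ specNorm (L - L') :=
  abs_le.2 ⟨by linarith [specNorm_sub_comm L L' ▸ E'.val_sub_val_le E k], E.val_sub_val_le E' k⟩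

/-- The matrix of inner products of the eigenvectors of two eigenbases. -/
def overlap (E : Eigenbasis L) (E' : Eigenbasis L') : Matrix (Fin n) (Fin n) ℝ :=
  E.vecᵀ * E'.vec

theorem overlap_mul_transpose (E : Eigenbasis L) (E' : Eigenbasis L') :
    E.overlap E' * (E.overlap E')ᵀ = 1 := by
  rw [overlap, Matrix.transpose_mul, Matrix.transpose_transpose, Matrix.mul_assoc,
    ← Matrix.mul_assoc E'.vec, E'.vec_mul_transpose, Matrix.one_mul, E.orthonormal]

theorem sum_overlap_sq (E : Eigenbasis L) (E' : Eigenbasis L') :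
    ∑ i, ∑ j, E.overlap E' i j ^ 2 = n := by
  rw [← frobNorm_sq, frobNorm_sq_eq_trace, mul_eq_one_comm.1 (E.overlap_mul_transpose E')]
  simp

/-- Multiplying by `Vᵀ` on the left and `W` on the right preserves the norm and leaves `D W - W D'`.
-/
theorem frobNorm_diagonal_sub_sq (E : Eigenbasis L) (E' : Eigenbasis L') (d d' : Fin n → ℝ) :
    frobNorm (E.vec * Matrix.diagonal d - E'.vec * Matrix.diagonal d' * (E.overlap E')ᵀ) ^ 2
      = ∑ i, ∑ j, (d i - d' j) ^ 2 * E.overlap E' i j ^ 2 := by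
  have hW := E.overlap_mul_transpose E'
  have hE : E.vecᵀᵀ * E.vecᵀ = 1 := by simpa using E.vec_mul_transpose
  rw [← frobNorm_orthogonal_mul hE, ← frobNorm_mul_orthogonal hW, Matrix.mul_sub, Matrix.sub_mul,
    ← Matrix.mul_assoc, E.orthonormal, Matrix.one_mul, ← Matrix.mul_assoc, Matrix.mul_assoc _ _ᵀ,
    mul_eq_one_comm.1 hW, Matrix.mul_one, ← Matrix.mul_assoc, ← overlap, frobNorm_sq]
  refine Finset.sum_congr rfl fun i _ => Finset.sum_congr rfl fun j _ => ?_
  rw [Matrix.sub_apply, Matrix.diagonal_mul, Matrix.mul_diagonal]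
  ring

/-- Since `V' D' Wᵀ = L' V`, the preceding identity computes the norm of `(L - L') V`. -/
theorem frobNorm_sub_sq (E : Eigenbasis L) (E' : Eigenbasis L') :
    frobNorm (L - L') ^ 2 = ∑ i, ∑ j, (E.val i - E'.val j) ^ 2 * E.overlap E' i j ^ 2 := by
  rw [← E.frobNorm_diagonal_sub_sq E', ← frobNorm_mul_orthogonal (U := E.vec) E.vec_mul_transpose,
    Matrix.sub_mul, E.eigen]
  conv_lhs => rw [E'.spectral]
  rw [overlap, Matrix.transpose_mul, Matrix.transpose_transpose]
  simp only [Matrix.mul_assoc]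

/-- Cauchy–Schwarz against the weights `W_ij²`, whose total mass is `n`. -/
theorem sum_abs_mul_overlap_sq_le (E : Eigenbasis L) (E' : Eigenbasis L') :
    ∑ i, ∑ j, |E.val i - E'.val j| * E.overlap E' i j ^ 2 ≤ √n * frobNorm (L - L') := by
  refine le_of_sq_le_sq ?_ (mul_nonneg (Real.sqrt_nonneg _) (frobNorm_nonneg _))
  rw [mul_pow, Real.sq_sqrt n.cast_nonneg, E.frobNorm_sub_sq E', ← E.sum_overlap_sq E']
  simp only [← Finset.sum_product']
  convert Finset.sum_mul_sq_le_sq_mul_sq (Finset.univ ×ˢ Finset.univ)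
    (fun p : Fin n × Fin n => E.overlap E' p.1 p.2)
    (fun p => |E.val p.1 - E'.val p.2| * E.overlap E' p.1 p.2) using 3 with p
  · ring
  · rw [mul_pow, sq_abs]

theorem sum_distinct {M : Type*} [AddCommGroup M] [Module ℝ M] (E : Eigenbasis L) (g : ℝ → M) :
    ∑ lam ∈ E.distinct, (E.mult lam : ℝ) • g lam = ∑ k, g (E.val k) := by
  rw [Finset.sum_comp g E.val]
  simp only [Nat.cast_smul_eq_nsmul]
  rfl

/-- The eigenbasis of a simultaneous permutation of rows and columns. -/
def perm (σ : Equiv.Perm (Fin n)) (E : Eigenbasis L) :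
    Eigenbasis (σ.permMatrix ℝ * L * (σ.permMatrix ℝ)ᵀ) where
  val := E.val
  vec := σ.permMatrix ℝ * E.vec
  monotone_val := E.monotone_val
  orthonormal := by
    rw [Matrix.transpose_mul, Matrix.mul_assoc, ← Matrix.mul_assoc _ (σ.permMatrix ℝ),
      Matrix.transpose_permMatrix, ← Matrix.permMatrix_mul, mul_inv_cancel, Matrix.permMatrix_one,
      Matrix.one_mul, E.orthonormal]
  eigen := by
    rw [Matrix.mul_assoc, ← Matrix.mul_assoc _ (σ.permMatrix ℝ) E.vec,
      Matrix.transpose_permMatrix, ← Matrix.permMatrix_mul, mul_inv_cancel, Matrix.permMatrix_one,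
      Matrix.one_mul, Matrix.mul_assoc, E.eigen, Matrix.mul_assoc]

theorem smooth_eq (E : Eigenbasis L) (ρ : ℝ≥0 → ℝ) (lam : ℝ) :
    E.smooth ρ lam = E.vec * Matrix.diagonal fun k => ρ (Real.nnabs (E.val k - lam)) := by
  ext i k
  simp [smooth, Matrix.mul_diagonal]

theorem perm_smooth (σ : Equiv.Perm (Fin n)) (E : Eigenbasis L) (ρ : ℝ≥0 → ℝ) (lam : ℝ) :
    (E.perm σ).smooth ρ lam = σ.permMatrix ℝ * E.smooth ρ lam := by
  rw [smooth_eq, smooth_eq, ← Matrix.mul_assoc]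
  rfl

end Eigenbasis

theorem permMatrix_mul_apply {n b : ℕ} (σ : Equiv.Perm (Fin n)) (X : Matrix (Fin n) (Fin b) ℝ)
    (i : Fin n) : (σ.permMatrix ℝ * X) i = X (σ i) := by
  rw [Equiv.Perm.permMatrix, PEquiv.toMatrix_toPEquiv_mul]
  rfl

end OGE

namespace OGE

/-! ### Hölder estimate for smoothed eigenvectors. -/

section Smoothing

variable {n : ℕ} {L L' : Matrix (Fin n) (Fin n) ℝ} {ρ : ℝ≥0 → ℝ} {Jρ : ℝ}

/-- Values of `ρ` differ by at most 1, so the square of a difference is at most the difference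
itself. This linear bound in `|s - t|` is the source of `√Jρ` and of the exponent 1/2. -/
theorem sq_smoothing_sub_le (hρ : IsSmoothing ρ) (hJρ : 0 ≤ Jρ)
    (hρLip : ∀ x x' : ℝ≥0, |ρ x - ρ x'| ≤ Jρ * |(x : ℝ) - (x' : ℝ)|) (s t lam lam' : ℝ) :
    (ρ (Real.nnabs (s - lam)) - ρ (Real.nnabs (t - lam'))) ^ 2
      ≤ 2 * Jρ * |s - t| + 2 * Jρ ^ 2 * |lam - lam'| ^ 2 := by
  set u := ρ (Real.nnabs (s - lam))
  set v := ρ (Real.nnabs (t - lam))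
  set w := ρ (Real.nnabs (t - lam'))
  have huv : |u - v| ≤ Jρ * |s - t| := by
    refine (hρLip _ _).trans (mul_le_mul_of_nonneg_left ?_ hJρ)
    simpa using abs_abs_sub_abs_le_abs_sub (s - lam) (t - lam)
  have hvw : |v - w| ≤ Jρ * |lam - lam'| := by
    refine (hρLip _ _).trans (mul_le_mul_of_nonneg_left ?_ hJρ)
    have h := abs_abs_sub_abs_le_abs_sub (t - lam) (t - lam')
    rw [sub_sub_sub_cancel_left, abs_sub_comm lam'] at h
    simpa using h
  have huv1 : |u - v| ≤ 1 := by
    have hu := hρ.mem_Icc (Real.nnabs (s - lam))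
    have hv := hρ.mem_Icc (Real.nnabs (t - lam))
    exact abs_le.2 ⟨by linarith [hu.1, hv.2], by linarith [hu.2, hv.1]⟩
  have h1 : (u - v) ^ 2 ≤ Jρ * |s - t| := by
    rw [← sq_abs]
    nlinarith [abs_nonneg (u - v)]
  have h2 : (v - w) ^ 2 ≤ Jρ ^ 2 * |lam - lam'| ^ 2 := by
    rw [← sq_abs, ← mul_pow]
    gcongr
  nlinarith [sq_nonneg (u - v - (v - w))]

/-- Up to the rotation aligning the eigenbases, smoothed eigenvectors are Hölder-`1/2` in the
matrix. -/
theorem frobNorm_smooth_sub_le (hρ : IsSmoothing ρ) (hJρ : 0 ≤ Jρ)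
    (hρLip : ∀ x x' : ℝ≥0, |ρ x - ρ x'| ≤ Jρ * |(x : ℝ) - (x' : ℝ)|)
    (E : Eigenbasis L) (E' : Eigenbasis L') (k : Fin n) :
    frobNorm (E.smooth ρ (E.val k) - E'.smooth ρ (E'.val k) * (E.overlap E')ᵀ)
      ≤ 2 * n * Jρ * specNorm (L - L')
        + 4 * (2 : ℝ) ^ (1 / 4 : ℝ) * √Jρ * n * frobNorm (L - L') ^ (1 / 2 : ℝ) := by
  have hS := specNorm_nonneg (L - L')
  have hF := frobNorm_nonneg (L - L')
  have hn : (1 : ℝ) ≤ n := by exact_mod_cast k.pos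
  have hsq : frobNorm (E.smooth ρ (E.val k) - E'.smooth ρ (E'.val k) * (E.overlap E')ᵀ) ^ 2
      ≤ 2 * Jρ * (√n * frobNorm (L - L')) + 2 * Jρ ^ 2 * specNorm (L - L') ^ 2 * n := by
    rw [E.smooth_eq, E'.smooth_eq, E.frobNorm_diagonal_sub_sq E']
    calc _ ≤ ∑ i, ∑ j, (2 * Jρ * |E.val i - E'.val j| + 2 * Jρ ^ 2 * specNorm (L - L') ^ 2)
            * E.overlap E' i j ^ 2 := by
          refine Finset.sum_le_sum fun i _ => Finset.sum_le_sum fun j _ => ?_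
          gcongr
          refine (sq_smoothing_sub_le hρ hJρ hρLip _ _ _ _).trans ?_
          gcongr
          exact E.abs_val_sub_val_le E' k
      _ = 2 * Jρ * (∑ i, ∑ j, |E.val i - E'.val j| * E.overlap E' i j ^ 2)
            + 2 * Jρ ^ 2 * specNorm (L - L') ^ 2 * ∑ i, ∑ j, E.overlap E' i j ^ 2 := by
          simp only [Finset.mul_sum, ← Finset.sum_add_distrib]
          exact Finset.sum_congr rfl fun i _ => Finset.sum_congr rfl fun j _ => by ring
      _ ≤ _ := by
          rw [E.sum_overlap_sq E']
          gcongr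
          exact E.sum_abs_mul_overlap_sq_le E'
  rw [← Real.sqrt_eq_rpow]
  -- The factor `2 ^ (1/4)` is slack: the bound is proved with 1 in its place.
  have hc : (1 : ℝ) ≤ (2 : ℝ) ^ (1 / 4 : ℝ) := Real.one_le_rpow (by norm_num) (by norm_num)
  have hb : 4 * √Jρ * n * √(frobNorm (L - L'))
      ≤ 4 * (2 : ℝ) ^ (1 / 4 : ℝ) * √Jρ * n * √(frobNorm (L - L')) := by
    gcongr
    linarith
  refine le_trans ?_ (add_le_add_right hb _)
  refine le_of_sq_le_sq (hsq.trans ?_) (by positivity)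
  have hsqrt : √(n : ℝ) ≤ (n : ℝ) ^ 2 := by
    refine Real.sqrt_le_iff.2 ⟨by positivity, ?_⟩
    rw [← pow_mul]
    exact le_self_pow₀ hn (by norm_num)
  -- The two pure squares already dominate `hsq`; the cross term is nonnegative and is dropped.
  have hexp : (2 * n * Jρ * specNorm (L - L') + 4 * √Jρ * n * √(frobNorm (L - L'))) ^ 2
      = 4 * n ^ 2 * Jρ ^ 2 * specNorm (L - L') ^ 2 + 16 * Jρ * n ^ 2 * frobNorm (L - L')
        + 16 * n ^ 2 * Jρ * specNorm (L - L') * √Jρ * √(frobNorm (L - L')) := by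
    linear_combination (16 * n ^ 2 * √(frobNorm (L - L')) ^ 2) * Real.sq_sqrt hJρ
      + (16 * Jρ * n ^ 2) * Real.sq_sqrt hF
  rw [hexp]
  have t1 : 2 * Jρ * (√n * frobNorm (L - L')) ≤ 2 * Jρ * ((n : ℝ) ^ 2 * frobNorm (L - L')) := by
    gcongr
  have t2 : 2 * Jρ ^ 2 * specNorm (L - L') ^ 2 * n
      ≤ 2 * Jρ ^ 2 * specNorm (L - L') ^ 2 * (n : ℝ) ^ 2 := by
    gcongr
    exact le_self_pow₀ hn (by norm_num)
  have t3 : 0 ≤ Jρ * ((n : ℝ) ^ 2 * frobNorm (L - L')) := by positivity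
  have t4 : 0 ≤ Jρ ^ 2 * specNorm (L - L') ^ 2 * (n : ℝ) ^ 2 := by positivity
  have t5 : 0 ≤ 16 * n ^ 2 * Jρ * specNorm (L - L') * √Jρ * √(frobNorm (L - L')) := by positivity
  linarith

end Smoothing

/-! ### Equivariance and stability of the augmentation. -/

section Augmentation

variable {n m : ℕ} {L L' : Matrix (Fin n) (Fin n) ℝ}

theorem frobNorm_concatConst_sub_le (s t : ℝ) (v w : Matrix (Fin n) (Fin 1) ℝ) :
    frobNorm (concatConst s v - concatConst t w) ≤ √n * |s - t| + frobNorm (v - w) := by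
  have h0 := frobNorm_nonneg (v - w)
  refine le_of_sq_le_sq ?_ (by positivity)
  have h : frobNorm (concatConst s v - concatConst t w) ^ 2
      = n * |s - t| ^ 2 + frobNorm (v - w) ^ 2 := by
    simp [frobNorm_sq, concatConst, Fin.sum_univ_two, Finset.sum_add_distrib]
  rw [h, add_sq, mul_pow, Real.sq_sqrt n.cast_nonneg]
  have : 0 ≤ 2 * (√n * |s - t|) * frobNorm (v - w) := by positivity
  linarith

theorem ogeAug_perm (ψ : (Fin m → ℝ) → ℝ) (φ : (Fin 2 → ℝ) → Fin m → ℝ)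
    {f : Matrix (Fin n) (Fin n) ℝ → Matrix (Fin n) (Fin 1) ℝ} (ρ : ℝ≥0 → ℝ)
    (hf : IsInvariantEncoder f) (E : Eigenbasis L) (σ : Equiv.Perm (Fin n)) :
    ogeAug ψ φ f ρ (E.perm σ) = σ.permMatrix ℝ * ogeAug ψ φ f ρ E := by
  have hfσ : ∀ V, f (σ.permMatrix ℝ * V) = σ.permMatrix ℝ * f V := fun V => by
    simpa using hf σ 1 V
  ext i j
  rw [permMatrix_mul_apply]
  simp only [ogeAug, rowwiseScalar, Matrix.of_apply]
  congr 1
  ext l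
  rw [Matrix.sum_apply, Matrix.sum_apply]
  refine Finset.sum_congr rfl fun lam _ => ?_
  simp only [Matrix.smul_apply, rowwise, concatConst, Matrix.of_apply,
    Eigenbasis.perm_smooth, hfσ, permMatrix_mul_apply]
  rfl

/-- Stability of the augmentation as a function of a symmetric matrix. -/
theorem frobNorm_ogeAug_sub_le {ψ : (Fin m → ℝ) → ℝ} {φ : (Fin 2 → ℝ) → Fin m → ℝ}
    {f : Matrix (Fin n) (Fin n) ℝ → Matrix (Fin n) (Fin 1) ℝ} {ρ : ℝ≥0 → ℝ}
    {Jψ Jφ Jρ Jf : ℝ} (hJψ : 0 ≤ Jψ) (hJφ : 0 ≤ Jφ) (hJρ : 0 ≤ Jρ) (hJf : 0 ≤ Jf)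
    (hρ : IsSmoothing ρ)
    (hψLip : ∀ X X' : Matrix (Fin n) (Fin m) ℝ,
      frobNorm (rowwiseScalar n ψ X - rowwiseScalar n ψ X') ≤ Jψ * frobNorm (X - X'))
    (hφLip : ∀ X X' : Matrix (Fin n) (Fin 2) ℝ,
      frobNorm (rowwise n φ X - rowwise n φ X') ≤ Jφ * frobNorm (X - X'))
    (hρLip : ∀ x x' : ℝ≥0, |ρ x - ρ x'| ≤ Jρ * |(x : ℝ) - (x' : ℝ)|)
    (hfLip : ∀ X X' : Matrix (Fin n) (Fin n) ℝ,
      frobNorm (f X - f X')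
        ≤ Jf * ⨅ Q : Matrix.orthogonalGroup (Fin n) ℝ,
            frobNorm (X - X' * (Q : Matrix (Fin n) (Fin n) ℝ)))
    (E : Eigenbasis L) (E' : Eigenbasis L') :
    frobNorm (ogeAug ψ φ f ρ E - ogeAug ψ φ f ρ E')
      ≤ n * Jψ * Jφ * ((√n + 2 * n * Jρ * Jf) * specNorm (L - L')
          + 4 * (2 : ℝ) ^ (1 / 4 : ℝ) * Jf * √Jρ * n * frobNorm (L - L') ^ (1 / 2 : ℝ)) := by
  set B := (√n + 2 * n * Jρ * Jf) * specNorm (L - L')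
          + 4 * (2 : ℝ) ^ (1 / 4 : ℝ) * Jf * √Jρ * n * frobNorm (L - L') ^ (1 / 2 : ℝ) with hB
  have hf : ∀ k, frobNorm (f (E.smooth ρ (E.val k)) - f (E'.smooth ρ (E'.val k)))
      ≤ Jf * (2 * n * Jρ * specNorm (L - L')
        + 4 * (2 : ℝ) ^ (1 / 4 : ℝ) * √Jρ * n * frobNorm (L - L') ^ (1 / 2 : ℝ)) := fun k => by
    refine (hfLip _ _).trans (mul_le_mul_of_nonneg_left ?_ hJf)
    -- The infimum over rotations is bounded by its value at the aligning rotation.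
    have hmem : (E.overlap E')ᵀ ∈ Matrix.orthogonalGroup (Fin n) ℝ := by
      rw [Matrix.mem_orthogonalGroup_iff', Matrix.transpose_transpose]
      exact E.overlap_mul_transpose E'
    have hbdd : BddBelow (Set.range fun Q : Matrix.orthogonalGroup (Fin n) ℝ =>
        frobNorm (E.smooth ρ (E.val k)
          - E'.smooth ρ (E'.val k) * (Q : Matrix (Fin n) (Fin n) ℝ))) :=
      ⟨0, Set.forall_mem_range.2 fun Q => frobNorm_nonneg _⟩
    exact (ciInf_le hbdd ⟨(E.overlap E')ᵀ, hmem⟩).trans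
      (frobNorm_smooth_sub_le hρ hJρ hρLip E E' k)
  have hterm : ∀ k, frobNorm (rowwise n φ (concatConst (E.val k) (f (E.smooth ρ (E.val k))))
      - rowwise n φ (concatConst (E'.val k) (f (E'.smooth ρ (E'.val k))))) ≤ Jφ * B := fun k => by
    refine (hφLip _ _).trans (mul_le_mul_of_nonneg_left ?_ hJφ)
    refine (frobNorm_concatConst_sub_le _ _ _ _).trans ?_
    have hw := mul_le_mul_of_nonneg_left (E.abs_val_sub_val_le E' k) (Real.sqrt_nonneg n)
    linarith [hf k]
  refine (hψLip _ _).trans ?_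
  rw [E.sum_distinct fun lam => rowwise n φ (concatConst lam (f (E.smooth ρ lam))),
    E'.sum_distinct fun lam => rowwise n φ (concatConst lam (f (E'.smooth ρ lam))),
    ← Finset.sum_sub_distrib]
  calc _ ≤ Jψ * ∑ _k : Fin n, Jφ * B :=
        mul_le_mul_of_nonneg_left
          ((frobNorm_sum_le _ _).trans (Finset.sum_le_sum fun k _ => hterm k)) hJψ
    _ = n * Jψ * Jφ * B := by
        rw [Finset.sum_const, Finset.card_univ, Fintype.card_fin, nsmul_eq_mul]
        ring

end Augmentation

end OGE

/-- There are finitely many graphs on `n` nodes. The bound lets the linear spectral-norm term be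
absorbed into the power 1/2. -/
theorem OGE.exists_frobNorm_lapDiff_le (n : ℕ) :
    ∃ B : ℝ, 0 ≤ B ∧ ∀ (G G' : SimpleGraph (Fin n)) (σ : Equiv.Perm (Fin n)),
      frobNorm (lapDiff G G' σ) ≤ B := by
  obtain ⟨p, hp⟩ := Finite.exists_max
    fun p : SimpleGraph (Fin n) × SimpleGraph (Fin n) × Equiv.Perm (Fin n) =>
      frobNorm (lapDiff p.1 p.2.1 p.2.2)
  exact ⟨_, frobNorm_nonneg _, fun G G' σ => hp (G, G', σ)⟩

theorem proposition3 {n m : ℕ}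
    (ψ : (Fin m → ℝ) → ℝ) (φ : (Fin 2 → ℝ) → Fin m → ℝ)
    (f : Matrix (Fin n) (Fin n) ℝ → Matrix (Fin n) (Fin 1) ℝ) (ρ : ℝ≥0 → ℝ)
    (Jψ Jφ Jρ Jf δ : ℝ)
    (hJψ : 0 ≤ Jψ) (hJφ : 0 ≤ Jφ) (hJρ : 0 ≤ Jρ) (hJf : 0 < Jf) (hδ : 0 < δ)
    (hf : OGE.IsInvariantEncoder f) (hρ : OGE.IsSmoothing ρ)
    (hψLip : ∀ X X' : Matrix (Fin n) (Fin m) ℝ,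
      OGE.frobNorm (OGE.rowwiseScalar n ψ X - OGE.rowwiseScalar n ψ X')
        ≤ Jψ * OGE.frobNorm (X - X'))
    (hφLip : ∀ X X' : Matrix (Fin n) (Fin 2) ℝ,
      OGE.frobNorm (OGE.rowwise n φ X - OGE.rowwise n φ X') ≤ Jφ * OGE.frobNorm (X - X'))
    (hρLip : ∀ x x' : ℝ≥0, |ρ x - ρ x'| ≤ Jρ * |(x : ℝ) - (x' : ℝ)|)
    (hfLip : ∀ X X' : Matrix (Fin n) (Fin n) ℝ,
      OGE.frobNorm (f X - f X')
        ≤ Jf * ⨅ Q : Matrix.orthogonalGroup (Fin n) ℝ,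
            OGE.frobNorm (X - X' * (Q : Matrix (Fin n) (Fin n) ℝ)))
    (hρδ : ∀ x : ℝ≥0, δ < (x : ℝ) → ρ x = 0)
    (E : ∀ G : SimpleGraph (Fin n), OGE.Eigenbasis (OGE.laplacian G)) :
    OGE.IsStable (fun G => OGE.ogeAug ψ φ f ρ (E G)) ∧
    OGE.IsStableWithExponent (fun G => OGE.ogeAug ψ φ f ρ (E G)) (1 / 2) ∧
    ∀ (G G' : SimpleGraph (Fin n)) (σ : Equiv.Perm (Fin n)), OGE.IsOptimalMatching G G' σ →
      OGE.specNorm (OGE.lapDiff G G' σ) ≤ OGE.frobNorm (OGE.lapDiff G G' σ) ∧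
      OGE.frobNorm (OGE.ogeAug ψ φ f ρ (E G) - σ.permMatrix ℝ * OGE.ogeAug ψ φ f ρ (E G'))
        ≤ n * Jψ * Jφ *
          ((√n + 2 * n * Jρ * Jf) * OGE.specNorm (OGE.lapDiff G G' σ)
            + 4 * (2 : ℝ) ^ (1 / 4 : ℝ) * Jf * √Jρ * n
              * OGE.frobNorm (OGE.lapDiff G G' σ) ^ (1 / 2 : ℝ)) := by
  have bound : ∀ (G G' : SimpleGraph (Fin n)) (σ : Equiv.Perm (Fin n)),
      OGE.frobNorm (OGE.ogeAug ψ φ f ρ (E G) - σ.permMatrix ℝ * OGE.ogeAug ψ φ f ρ (E G'))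
        ≤ n * Jψ * Jφ *
          ((√n + 2 * n * Jρ * Jf) * OGE.specNorm (OGE.lapDiff G G' σ)
            + 4 * (2 : ℝ) ^ (1 / 4 : ℝ) * Jf * √Jρ * n
              * OGE.frobNorm (OGE.lapDiff G G' σ) ^ (1 / 2 : ℝ)) := fun G G' σ => by
    rw [← OGE.ogeAug_perm ψ φ ρ hf]
    exact OGE.frobNorm_ogeAug_sub_le hJψ hJφ hJρ hJf.le hρ hψLip hφLip hρLip hfLip
      (E G) ((E G').perm σ)
  have stable : OGE.IsStableWithExponent (fun G => OGE.ogeAug ψ φ f ρ (E G)) (1 / 2) := by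
    obtain ⟨B, hB, hlap⟩ := OGE.exists_frobNorm_lapDiff_le n
    -- The summand 1 keeps the constant positive when the product vanishes.
    refine ⟨n * Jψ * Jφ * ((√n + 2 * n * Jρ * Jf) * √B
      + 4 * (2 : ℝ) ^ (1 / 4 : ℝ) * Jf * √Jρ * n) + 1, by positivity, fun G G' σ _ => ?_⟩
    refine (bound G G' σ).trans ?_
    have hF := OGE.frobNorm_nonneg (OGE.lapDiff G G' σ)
    have hS : OGE.specNorm (OGE.lapDiff G G' σ)
        ≤ √B * OGE.frobNorm (OGE.lapDiff G G' σ) ^ (1 / 2 : ℝ) := by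
      rw [← Real.sqrt_eq_rpow]
      calc OGE.specNorm (OGE.lapDiff G G' σ) ≤ OGE.frobNorm (OGE.lapDiff G G' σ) :=
            OGE.specNorm_le_frobNorm _
        _ = √(OGE.frobNorm (OGE.lapDiff G G' σ)) * √(OGE.frobNorm (OGE.lapDiff G G' σ)) :=
            (Real.mul_self_sqrt hF).symm
        _ ≤ _ := by
            gcongr
            exact hlap G G' σ
    calc _ ≤ n * Jψ * Jφ * ((√n + 2 * n * Jρ * Jf)
              * (√B * OGE.frobNorm (OGE.lapDiff G G' σ) ^ (1 / 2 : ℝ))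
            + 4 * (2 : ℝ) ^ (1 / 4 : ℝ) * Jf * √Jρ * n
              * OGE.frobNorm (OGE.lapDiff G G' σ) ^ (1 / 2 : ℝ)) := by gcongr
      _ ≤ _ := by
        have : 0 ≤ OGE.frobNorm (OGE.lapDiff G G' σ) ^ (1 / 2 : ℝ) := by positivity
        linarith
  exact ⟨⟨1 / 2, by norm_num, stable⟩, stable,
    fun G G' σ _ => ⟨OGE.specNorm_le_frobNorm _, bound G G' σ⟩⟩
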